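/- **Setting.** Let $\mathcal H_0\subset L^2([0,1])$ be a real reproducing kernel Hilbert space of functions on $[0,1]$, all of whose members have integral zero. Let $\mu_1\ge\mu_2\ge\dots\ge 0$, $\mu_1=1$, be the eigenvalues of its kernel (as an integral operator on $L^2([0,1])$, listed with multiplicity, possibly with zeros) and let $\psi_1,\psi_2,\dots$ be corresponding eigenfunctions, orthonormal in $L^2([0,1])$, with $\int_0^1\psi_k=0$, whose closed linear span in $L^2([0,1])$ contains $\mathcal H_0$. For $1\le s\le p$ put $$\mathcal F_s=\Big\{f(x)=\sum_{j\in S}f_j(x_j)\;:\;S\subset\{1,\dots,p\},\ |S|\le s,\ f_j\in\mathcal H_0,\ \|f_j\|_{\mathcal H_0}\le 1\ (j\in S)\Big\}\subset L^2([0,1]^p).$$ For a positive integer $n$, under $P_f$ one observes the Gaussian white noise model $dY_x=f(x)\,dx+n^{-1/2}dB_x$, $x\in[0,1]^p$; that is, $\big(\int\varphi\,dY\big)_{\varphi\in L^2([0,1]^p)}$ is a Gaussian process with mean $\langle f,\varphi\rangle$ and covariance $\langle\varphi,\varphi'\rangle/n$. Put $X_{k,j}=\int\psi_k(x_j)\,dY_x$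 and, for integers $d\ge 1$ and reals $r\ge 0$, $$E_j(d)=n\sum_{k\le d}X_{k,j}^2,\qquad \alpha_r(d)=\frac{E\big(\|g\|^2\mathbf 1_{\{\|g\|^2\ge d+r^2\}}\big)}{P\{\|g\|^2\ge d+r^2\}}\ \ (g\sim N(0,I_d)),\qquad T_r(d)=\sum_{j=1}^p\big(E_j(d)-\alpha_r(d)\big)\mathbf 1_{\{E_j(d)\ge d+r^2\}}.$$ Let $\nu_{\mathcal H}$ be the smallest positive integer $\nu$ with $\mu_\nu\le\frac1n\sqrt{\nu\log(1+p/s^2)}$, and let $\tau(p,s,n)\ge 0$ be given by $\tau(p,s,n)^2=\frac{s\log(1+p/s^2)}{n}$. **Proposition (Tail).** For every constant $K_3>0$ there exist constants $K_1,K_2>0$ depending only on $K_3$ such that for every $\eta\in(0,1)$ there is $C_\eta>0$, depending only on $\eta$ and $K_3$, with the following property. Let $D>0$, let $\mathcal H_0,(\mu_k),(\psi_k)$ be as above, let $p,s,n$ be positive integers with $1\le s<\sqrt p$, set $d=\nu_{\mathcal H}\vee\lceil D\rceil$, and suppose that $\log(1+p/s^2)\ge K_3^2\,d$. Then, with $r=K_2\sqrt{\log(1+p/s^2)}$,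 for all $C>C_\eta$, $$P_0\big\{T_r(d)>CK_1n\,\tau(p,s,n)^2\big\}+\sup_{\substack{f\in\mathcal F_s,\\ \|f\|_2\ge C\tau(p,s,n)}}P_f\big\{T_r(d)\le CK_1n\,\tau(p,s,n)^2\big\}\le\eta .$$ (A supremum over an empty set is $0$.) -/

import Mathlib

open MeasureTheory ProbabilityTheory
open scoped ENNReal RealInnerProductSpace

noncomputable section

namespace SparseAdditive

/-- The space `L²([0,1])`. -/
abbrev L2I : Type := Lp ℝ 2 (volume : Measure unitInterval)

/-- The space `L²([0,1]^p)`. -/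
abbrev L2Cube (p : ℕ) : Type := Lp ℝ 2 (volume : Measure (Fin p → unitInterval))

/-- `H` is a reproducing kernel Hilbert space of functions on `[0,1]`, contained in `L²([0,1])`, all
of whose members have integral zero; `μ 0 ≥ μ 1 ≥ … ≥ 0` with `μ 0 = 1` are the eigenvalues of its
kernel (listed with multiplicity, `μ k` being the `(k+1)`-st one), and `ψ 0, ψ 1, …` are
corresponding eigenfunctions, orthonormal in `L²([0,1])` and with integral zero.

`span` says that the list of eigenfunctions is exhaustive. Eigenvalues may be zero, which covers
kernels of finite rank. -/
structure IsCenteredEigensystem (H : Type*) [NormedAddCommGroup H] [InnerProductSpace ℝ H]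
    [CompleteSpace H] [RKHS ℝ H unitInterval ℝ] (μ : ℕ → ℝ) (ψ : ℕ → L2I) : Prop where
  memLp : ∀ g : H, MemLp (fun t => g t) 2 (volume : Measure unitInterval)
  integral_eq_zero : ∀ g : H, ∫ t, g t = 0
  antitone : Antitone μ
  nonneg : ∀ k, 0 ≤ μ k
  first : μ 0 = 1
  orthonormal : Orthonormal ℝ ψ
  integral_eigenfunction : ∀ k, ∫ t, ψ k t = 0
  eigen : ∀ k, ∀ᵐ x : unitInterval, ∫ y, RKHS.kernel H x y 1 * ψ k y = μ k * ψ k x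
  span : ∀ g : H, (memLp g).toLp (fun t => g t) ∈
    (Submodule.span ℝ (Set.range ψ)).topologicalClosure

/-- The parameter space `𝓕_s`: sums `f(x) = ∑_{j ∈ S} f_j(x_j)` with `|S| ≤ s` and every `f_j` in
the unit ball of `H`, as elements of `L²([0,1]^p)`. -/
def paramSpace (H : Type*) [NormedAddCommGroup H] [InnerProductSpace ℝ H]
    [RKHS ℝ H unitInterval ℝ] (p s : ℕ) : Set (L2Cube p) :=
  {f | ∃ S : Finset (Fin p), S.card ≤ s ∧ ∃ g : Fin p → H, (∀ j ∈ S, ‖g j‖ ≤ 1) ∧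
    ∀ᵐ x : Fin p → unitInterval, f x = ∑ j ∈ S, g j (x j)}

/-- Under `P`, the observation `Y` follows the Gaussian white noise model
`dY_x = f(x) dx + n^{-1/2} dB_x` on `[0,1]^p`. Here `Y φ` stands for `∫ φ(x) dY_x`: the family
`(Y φ)` indexed by `φ ∈ L²([0,1]^p)` is a Gaussian process with mean `⟨f, φ⟩` and
covariance `⟨φ, φ'⟩ / n`. -/
structure IsWhiteNoiseModel {Ω : Type*} [MeasurableSpace Ω] {p : ℕ} (n : ℕ) (f : L2Cube p)
    (Y : L2Cube p → Ω → ℝ) (P : Measure Ω) : Prop where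
  gaussian : IsGaussianProcess Y P
  mean : ∀ φ, ∫ ω, Y φ ω ∂P = ⟪f, φ⟫
  cov : ∀ φ φ', cov[Y φ, Y φ'; P] = ⟪φ, φ'⟫ / n

/-- The function `φ_{j,k}(t) = ψ_k(t_j)` on `[0,1]^p`. -/
def basisFun {p : ℕ} (ψ : ℕ → L2I) (k : ℕ) (j : Fin p) : L2Cube p :=
  Lp.compMeasurePreserving (fun t : Fin p → unitInterval => t j)
    (measurePreserving_eval (fun _ : Fin p => (volume : Measure unitInterval)) j) (ψ k)

/-- The data `X_{k,j} = ∫ φ_{j,k}(x) dY_x` (with `k` counted from zero). -/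
def coeffData {Ω : Type*} {p : ℕ} (ψ : ℕ → L2I) (Y : L2Cube p → Ω → ℝ) (k : ℕ) (j : Fin p)
    (ω : Ω) : ℝ :=
  Y (basisFun ψ k j) ω

/-- `E_j(d) = n ∑_{k ≤ d} X_{k,j}²`. -/
def energy {Ω : Type*} {p : ℕ} (ψ : ℕ → L2I) (Y : L2Cube p → Ω → ℝ) (n d : ℕ) (j : Fin p)
    (ω : Ω) : ℝ :=
  n * ∑ k ∈ Finset.range d, coeffData ψ Y k j ω ^ 2

/-- `α_r(d) = E(‖g‖² 1{‖g‖² ≥ d + r²}) / P{‖g‖² ≥ d + r²}` with `g ∼ N(0, I_d)`. -/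
def alpha (r : ℝ) (d : ℕ) : ℝ :=
  (∫ g in {g : EuclideanSpace ℝ (Fin d) | d + r ^ 2 ≤ ‖g‖ ^ 2}, ‖g‖ ^ 2
      ∂(stdGaussian (EuclideanSpace ℝ (Fin d)))) /
    (stdGaussian (EuclideanSpace ℝ (Fin d))).real {g | d + r ^ 2 ≤ ‖g‖ ^ 2}

/-- The statistic `T_r(d) = ∑_j (E_j(d) - α_r(d)) 1{E_j(d) ≥ d + r²}`. -/
def thresholdStat {Ω : Type*} {p : ℕ} (ψ : ℕ → L2I) (Y : L2Cube p → Ω → ℝ) (n : ℕ) (r : ℝ)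
    (d : ℕ) (ω : Ω) : ℝ :=
  ∑ j : Fin p, if d + r ^ 2 ≤ energy ψ Y n d j ω then energy ψ Y n d j ω - alpha r d else 0

/-- `log(1 + p / s²)`. -/
def logTerm (p s : ℕ) : ℝ := Real.log (1 + p / (s : ℝ) ^ 2)

/-- `ν_H`, the smallest positive integer `ν` whose eigenvalue, the `ν`-th one, is at most
`√(ν log(1 + p / s²)) / n`. -/
def truncIndex (μ : ℕ → ℝ) (p s n : ℕ) : ℕ :=
  sInf {ν : ℕ | 1 ≤ ν ∧ μ (ν - 1) ≤ √(ν * logTerm p s) / n}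

/-- `τ(p, s, n)`, given by `τ² = s log(1 + p / s²) / n`. -/
def tau (p s n : ℕ) : ℝ := √(s * logTerm p s / n)

/-- The total testing risk `P_0{T > u} + sup_{f ∈ A} P_f{T ≤ u}` of the test that rejects the null
hypothesis `f = 0` when `T > u`, against the set of alternatives `A`. -/
def totalRisk {Ω : Type*} [MeasurableSpace Ω] {p : ℕ} (P : L2Cube p → Measure Ω) (T : Ω → ℝ)
    (u : ℝ) (A : Set (L2Cube p)) : ℝ≥0∞ :=
  P 0 {ω | u < T ω} + ⨆ f ∈ A, P f {ω | T ω ≤ u}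

end SparseAdditive

end

open SparseAdditive

/-!
Put `L = log(1 + p / s²)`, which is at least `1/2`. The scaled coefficients `√n X_{k,j}` are
independent normal variables of variance one with means `m_{k,j} = √n ⟨f, φ_{j,k}⟩`, since the
functions `φ_{j,k}` are orthonormal. So the blocks belonging to different coordinates `j` are
independent, and a block without signal is standard Gaussian.

*Noise.* `α_r(d)` is the mean of `‖g‖²` conditioned on `‖g‖² ≥ d + r²`, hence the term of the
statistic of a coordinate without signal is centred. Its variance is at most
`E (‖g‖² - d - r²)² 1{‖g‖² ≥ d + r²}`, which the exponential moment `E exp(‖g‖²/4) ≤ e^d` bounds by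
`32 exp(d - r²/4)`. As `d ≤ L / K₃²` and `r² = K₂² L` with `K₂` large, this is at most
`32 e^{-L} ≤ 32 s² / p`. The noise of up to `p` coordinates thus has variance at most `32 s²`, and
Chebyshev's inequality makes it smaller than `C s L` (`IsWhiteNoiseModel.measure_abs_noise_ge_le`).

*Signal.* On the support `S` of `f`, with at most `s` elements, the terms are at least
`E_j - α_r(d)` because `α_r(d) ≥ d + r²`, while `α_r(d) ≤ A L` (`alpha_le`). The latter only needs the crude tail
bound `P(‖g‖² ≥ t) ≥ e^{-t-2}` together with the exponential moment. The sum of the `E_j`, `j ∈ S`,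
exceeds half of the signal energy `∑ m²` with high probability
(`IsWhiteNoiseModel.measure_energy_le_le`).

*Bias.* With eigenvalues counted from zero, the signal energy is at least `n ‖f‖² - n s μ d`: the
inclusion `ι` of `H` in `L²([0,1])` is bounded by the closed graph theorem, `ι ι†` is the integral
operator of the kernel, and so a function in the unit ball of `H` has squared norm at most `μ d`
beyond the first `d` eigenfunctions (`IsCenteredEigensystem.norm_sq_le`). By the choice of `ν_H` and
`d ≤ L / K₃²` the bias `n s μ d` is at most `s L / K₃`
(`IsCenteredEigensystem.eigenvalue_le`), which is small compared with `n ‖f‖² ≥ C² s L`.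
-/

open SparseAdditive

/-! ### Exponential moments and tails of chi-square variables -/

lemma integrable_exp_sq_div_four_gaussianReal :
    Integrable (fun x : ℝ => Real.exp (x ^ 2 / 4)) (gaussianReal 0 1) := by
  rw [gaussianReal_of_var_ne_zero _ one_ne_zero,
    integrable_withDensity_iff_integrable_smul' (measurable_gaussianPDF 0 1)
      (Filter.Eventually.of_forall fun x => gaussianPDF_lt_top)]
  have h := (integrable_exp_neg_mul_sq (b := 1 / 4) (by norm_num)).const_mul (√(2 * Real.pi * 1))⁻¹
  refine h.congr (Filter.Eventually.of_forall fun x => ?_)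
  simp only [toReal_gaussianPDF, gaussianPDFReal, smul_eq_mul, NNReal.coe_one]
  rw [mul_assoc (√_)⁻¹, ← Real.exp_add]
  congr 2
  ring

lemma integral_exp_sq_div_four_gaussianReal :
    ∫ x, Real.exp (x ^ 2 / 4) ∂(gaussianReal 0 1) = √2 := by
  rw [integral_gaussianReal_eq_integral_smul one_ne_zero]
  have h : ∀ x : ℝ, gaussianPDFReal 0 1 x • Real.exp (x ^ 2 / 4) =
      (√(2 * Real.pi))⁻¹ * Real.exp (-(1 / 4) * x ^ 2) := by
    intro x
    simp only [gaussianPDFReal, smul_eq_mul, NNReal.coe_one, mul_one]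
    rw [mul_assoc, ← Real.exp_add]
    congr 2
    ring
  simp_rw [h]
  rw [integral_const_mul, integral_gaussian, ← Real.sqrt_inv, ← Real.sqrt_mul (by positivity)]
  congr 1
  field_simp
  norm_num

lemma integrable_exp_sq_norm_div_four_stdGaussian (d : ℕ) :
    Integrable (fun g : EuclideanSpace ℝ (Fin d) => Real.exp (‖g‖ ^ 2 / 4))
      (stdGaussian (EuclideanSpace ℝ (Fin d))) := by
  rw [← map_pi_eq_stdGaussian, integrable_map_measure (by fun_prop) (by fun_prop)]
  have h := Integrable.fintype_prod (μ := fun _ : Fin d => gaussianReal 0 1)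
    (f := fun _ x => Real.exp (x ^ 2 / 4)) (fun _ => integrable_exp_sq_div_four_gaussianReal)
  refine h.congr (Filter.Eventually.of_forall fun x => ?_)
  simp only [Function.comp_apply, EuclideanSpace.real_norm_sq_eq, ← Real.exp_sum, Finset.sum_div]

lemma integral_exp_sq_norm_div_four_stdGaussian_le (d : ℕ) :
    ∫ g, Real.exp (‖g‖ ^ 2 / 4) ∂(stdGaussian (EuclideanSpace ℝ (Fin d))) ≤ Real.exp d := by
  rw [← map_pi_eq_stdGaussian, integral_map (by fun_prop) (by fun_prop)]
  simp only [EuclideanSpace.real_norm_sq_eq, Finset.sum_div, Real.exp_sum]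
  rw [integral_fintype_prod_eq_pow (fun x : ℝ => Real.exp (x ^ 2 / 4)),
    integral_exp_sq_div_four_gaussianReal, Fintype.card_fin, ← mul_one (d : ℝ), Real.exp_nat_mul]
  gcongr
  rw [Real.sqrt_le_left (Real.exp_pos 1).le]
  nlinarith [Real.add_one_le_exp 1]

/-- A crude lower bound for the upper tail of the standard normal law, from the mass of the interval
`[√t, √t + 1]`. -/
lemma exp_le_gaussianReal_sq_ge {t : ℝ} (ht : 0 ≤ t) :
    Real.exp (-t - 2) ≤ (gaussianReal 0 1).real {x | t ≤ x ^ 2} := by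
  have hsub : Set.Icc (√t) (√t + 1) ⊆ {x | t ≤ x ^ 2} := fun x hx => by
    rw [Set.mem_ofPred_eq, ← Real.sqrt_le_left (by linarith [Real.sqrt_nonneg t, hx.1])]
    exact hx.1
  refine le_trans ?_ (measureReal_mono hsub)
  have hd : ∀ x ∈ Set.Icc (√t) (√t + 1), Real.exp (-t - 2) ≤ gaussianPDFReal 0 1 x := by
    intro x hx
    have hx0 : 0 ≤ x := (Real.sqrt_nonneg t).trans hx.1
    have hx2 : x ^ 2 ≤ 2 * t + 2 := by
      have := Real.sq_sqrt ht
      nlinarith [hx.2, hx.1, sq_nonneg (√t - 1)]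
    have hpi : Real.exp (-1) ≤ (√(2 * Real.pi))⁻¹ := by
      rw [Real.exp_neg]
      gcongr
      rw [Real.sqrt_le_left (Real.exp_pos 1).le]
      have := Real.exp_one_gt_d9
      have := Real.pi_lt_d2
      nlinarith
    calc Real.exp (-t - 2) = Real.exp (-1) * Real.exp (-t - 1) := by
          rw [← Real.exp_add]; congr 1; ring
      _ ≤ (√(2 * Real.pi))⁻¹ * Real.exp (-x ^ 2 / 2) := by
          gcongr
          linarith
      _ = gaussianPDFReal 0 1 x := by simp [gaussianPDFReal]
  rw [measureReal_def, gaussianReal_apply_eq_integral _ one_ne_zero,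
    ENNReal.toReal_ofReal (integral_nonneg fun x => gaussianPDFReal_nonneg _ _ _)]
  calc Real.exp (-t - 2) = ∫ x in Set.Icc (√t) (√t + 1), Real.exp (-t - 2) := by simp
    _ ≤ ∫ x in Set.Icc (√t) (√t + 1), gaussianPDFReal 0 1 x :=
      setIntegral_mono_on (by simp) (integrable_gaussianPDFReal 0 1).integrableOn
        measurableSet_Icc hd

lemma exp_le_stdGaussian_sq_norm_ge {d : ℕ} (hd : 1 ≤ d) {t : ℝ} (ht : 0 ≤ t) :
    Real.exp (-t - 2) ≤ (stdGaussian (EuclideanSpace ℝ (Fin d))).real {g | t ≤ ‖g‖ ^ 2} := by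
  refine (exp_le_gaussianReal_sq_ge ht).trans ?_
  have hmp := measurePreserving_eval (fun _ : Fin d => gaussianReal 0 1) ⟨0, hd⟩
  rw [← map_pi_eq_stdGaussian, map_measureReal_apply (by fun_prop)
    (measurableSet_le measurable_const (by fun_prop)), ← hmp.measureReal_preimage
    (measurableSet_le measurable_const (by fun_prop)).nullMeasurableSet]
  refine measureReal_mono fun x hx => ?_
  simp only [Set.mem_preimage, Set.mem_ofPred_eq, Function.eval] at hx
  simp only [Set.mem_preimage, Set.mem_ofPred_eq, EuclideanSpace.real_norm_sq_eq]
  exact hx.trans (Finset.single_le_sum (f := fun i => x i ^ 2) (fun i _ => sq_nonneg _)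
    (Finset.mem_univ _))

section Truncation

variable {α : Type*} [MeasurableSpace α] {ν : Measure α} [IsProbabilityMeasure ν] {X : α → ℝ}
  {t a : ℝ}

omit [IsProbabilityMeasure ν] in
lemma memLp_two_of_integrable_exp (hX : Measurable X) (h0 : ∀ x, 0 ≤ X x)
    (hexp : Integrable (fun x => Real.exp (X x / 4)) ν) : MemLp X 2 ν := by
  rw [memLp_two_iff_integrable_sq hX.aestronglyMeasurable]
  refine (hexp.const_mul 32).mono' (by fun_prop) (Filter.Eventually.of_forall fun x => ?_)
  rw [Real.norm_of_nonneg (sq_nonneg _)]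
  have := Real.quadratic_le_exp_of_nonneg (x := X x / 4) (by linarith [h0 x])
  nlinarith [h0 x]

/-- The mean of `X` conditioned on `{X ≥ t}` is at least `t`. -/
lemma le_truncatedMean (hX : Measurable X) (hint : Integrable X ν)
    (hpos : 0 < ν.real {x | t ≤ X x}) :
    t ≤ (∫ x in {x | t ≤ X x}, X x ∂ν) / ν.real {x | t ≤ X x} := by
  rw [le_div_iff₀ hpos]
  have hA : MeasurableSet {x | t ≤ X x} := measurableSet_le measurable_const hX
  have := setIntegral_mono_on (μ := ν) (f := fun _ => t) (by simp) hint.integrableOn hA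
    (fun x hx => hx)
  simpa [mul_comm] using this

/-- The mean of `X` conditioned on an event of probability at least `q` is of order
`log (1 / q)` when `X` has an exponential moment. -/
lemma truncatedMean_le (hint : Integrable X ν)
    (hexp : Integrable (fun x => Real.exp (X x / 4)) ν) {b c : ℝ}
    (hb : ∫ x, Real.exp (X x / 4) ∂ν ≤ Real.exp b) (hc : Real.exp (-c) ≤ ν.real {x | t ≤ X x}) :
    (∫ x in {x | t ≤ X x}, X x ∂ν) / ν.real {x | t ≤ X x} ≤ 4 * (b + c) + 4 := by
  have hpos := (Real.exp_pos _).trans_le hc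
  rw [div_le_iff₀ hpos]
  set A := {x | t ≤ X x} with hAdef
  -- `x ≤ M + 4 exp ((x - M) / 4)` with `M = 4 (b + c)`
  have hpt : ∀ x, X x ≤ 4 * (b + c) + 4 * Real.exp (-(b + c)) * Real.exp (X x / 4) := fun x => by
    have := Real.add_one_le_exp (-(b + c) + X x / 4)
    rw [Real.exp_add] at this
    linarith
  calc ∫ x in A, X x ∂ν
      ≤ ∫ x in A, (4 * (b + c) + 4 * Real.exp (-(b + c)) * Real.exp (X x / 4)) ∂ν :=
        setIntegral_mono hint.integrableOn
          ((integrable_const _).add (hexp.const_mul _)).integrableOn hpt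
    _ = 4 * (b + c) * ν.real A + 4 * Real.exp (-(b + c)) * ∫ x in A, Real.exp (X x / 4) ∂ν := by
        rw [integral_add (integrable_const _) (hexp.const_mul _).integrableOn, integral_const,
          smul_eq_mul, measureReal_restrict_apply_univ, mul_comm (ν.real A), integral_const_mul]
    _ ≤ 4 * (b + c) * ν.real A + 4 * Real.exp (-(b + c)) * Real.exp b := by
        gcongr
        exact (setIntegral_le_integral hexp
          (Filter.Eventually.of_forall fun x => (Real.exp_pos _).le)).trans hb
    _ = 4 * (b + c) * ν.real A + 4 * Real.exp (-c) := by
        rw [mul_assoc 4 (Real.exp _), ← Real.exp_add]; congr 3; ring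
    _ ≤ (4 * (b + c) + 4) * ν.real A := by linarith

lemma setIntegral_sub_truncatedMean (hint : Integrable X ν)
    (hpos : 0 < ν.real {x | t ≤ X x})
    (ha : a = (∫ x in {x | t ≤ X x}, X x ∂ν) / ν.real {x | t ≤ X x}) :
    ∫ x in {x | t ≤ X x}, (X x - a) ∂ν = 0 := by
  rw [integral_sub hint.integrableOn (by simp), ha]
  simp only [integral_const, smul_eq_mul, measureReal_restrict_apply_univ]
  field_simp
  simp

/-- Centring at the conditional mean minimises the quadratic loss, so that the threshold `t` may
replace it; then `(x - t)² ≤ 32 exp ((x - t) / 4)` for `x ≥ t`. -/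
lemma setIntegral_sub_truncatedMean_sq_le (hX : Measurable X) (hL : MemLp X 2 ν)
    (hexp : Integrable (fun x => Real.exp (X x / 4)) ν)
    (hpos : 0 < ν.real {x | t ≤ X x})
    (ha : a = (∫ x in {x | t ≤ X x}, X x ∂ν) / ν.real {x | t ≤ X x}) :
    ∫ x in {x | t ≤ X x}, (X x - a) ^ 2 ∂ν ≤
      32 * Real.exp (-t / 4) * ∫ x, Real.exp (X x / 4) ∂ν := by
  have hint : Integrable X ν := hL.integrable (by norm_num)
  have h0 := setIntegral_sub_truncatedMean hint hpos ha
  set A := {x | t ≤ X x} with hAdef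
  have hA : MeasurableSet A := measurableSet_le measurable_const hX
  have hsq : ∀ c : ℝ, Integrable (fun x => (X x - c) ^ 2) ν := fun c =>
    (hL.sub (memLp_const c)).integrable_sq
  have hlin : Integrable (fun x => 2 * (a - t) * (X x - a)) ν :=
    (hint.sub (integrable_const a)).const_mul _
  calc ∫ x in A, (X x - a) ^ 2 ∂ν
      ≤ ∫ x in A, ((X x - t) ^ 2 - 2 * (a - t) * (X x - a)) ∂ν := by
        refine setIntegral_mono (hsq a).integrableOn
          ((hsq t).sub hlin).integrableOn fun x => ?_
        simp only
        nlinarith [sq_nonneg (a - t)]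
    _ = ∫ x in A, (X x - t) ^ 2 ∂ν := by
        rw [integral_sub (hsq t).integrableOn hlin.integrableOn, integral_const_mul, h0]
        simp
    _ ≤ ∫ x in A, 32 * Real.exp (-t / 4) * Real.exp (X x / 4) ∂ν := by
        refine setIntegral_mono_on (hsq t).integrableOn (hexp.const_mul _).integrableOn hA
          fun x hx => ?_
        have hx' : t ≤ X x := hx
        have := Real.quadratic_le_exp_of_nonneg (x := (X x - t) / 4) (by linarith)
        rw [mul_assoc, ← Real.exp_add, show -t / 4 + X x / 4 = (X x - t) / 4 by ring]
        nlinarith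
    _ ≤ ∫ x, 32 * Real.exp (-t / 4) * Real.exp (X x / 4) ∂ν :=
        setIntegral_le_integral (hexp.const_mul _)
          (Filter.Eventually.of_forall fun x => by positivity)
    _ = _ := integral_const_mul _ _

end Truncation

/-! ### The reproducing kernel Hilbert space in `L²([0,1])` -/

lemma Orthonormal.hasSum_inner_sq_of_mem_closure {E : Type*} [NormedAddCommGroup E]
    [InnerProductSpace ℝ E] [CompleteSpace E] {ψ : ℕ → E} (hψ : Orthonormal ℝ ψ) {u : E}
    (hu : u ∈ (Submodule.span ℝ (Set.range ψ)).topologicalClosure) :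
    HasSum (fun k => ⟪ψ k, u⟫ ^ 2) (‖u‖ ^ 2) := by
  have hV := hψ.orthogonalFamily
  have hr := hV.range_linearIsometry
  have hsup : (⨆ i, LinearMap.range (LinearIsometry.toSpanSingleton ℝ E (hψ.1 i)).toLinearMap) =
      Submodule.span ℝ (Set.range ψ) := by
    rw [Submodule.span_range_eq_iSup]
    congr 1
    ext1 i
    exact LinearMap.range_toSpanSingleton _
  rw [hsup] at hr
  rw [← hr] at hu
  obtain ⟨f, rfl⟩ := hu
  have hc : ∀ k, ⟪ψ k, hV.linearIsometry f⟫ = f k := fun k => by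
    have h1 : ψ k = hV.linearIsometry (lp.single 2 k (1 : ℝ)) := by
      rw [hV.linearIsometry_apply_single]
      simp
    rw [h1, LinearIsometry.inner_map_map, lp.inner_single_left]
    simp
  have hn : ‖hV.linearIsometry f‖ ^ 2 = ⟪f, f⟫ := by
    rw [LinearIsometry.norm_map, real_inner_self_eq_norm_sq]
  change HasSum (fun k => ⟪ψ k, hV.linearIsometry f⟫ ^ 2) (‖hV.linearIsometry f‖ ^ 2)
  rw [hn]
  simp only [hc]
  simpa only [RCLike.inner_apply, conj_trivial, ← sq] using lp.hasSum_inner (𝕜 := ℝ) f f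

/-- If `A A†` has eigenvectors `ψ k` with eigenvalues `μ k` decreasing, then the component of `A g`
beyond the first `d` eigenvectors is controlled by `μ d`: pairing `g` with
`A† (∑ ⟪ψ k, A g⟫ ψ k)` and the Cauchy–Schwarz inequality bound every finite piece of it. -/
lemma norm_sq_le_sum_inner_sq_add {H E : Type*} [NormedAddCommGroup H] [InnerProductSpace ℝ H]
    [CompleteSpace H] [NormedAddCommGroup E] [InnerProductSpace ℝ E] [CompleteSpace E]
    (A : H →L[ℝ] E) {μ : ℕ → ℝ} {ψ : ℕ → E} (hμ : Antitone μ)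
    (hμ0 : ∀ k, 0 ≤ μ k) (hψ : Orthonormal ℝ ψ)
    (hA : ∀ k, A (A.adjoint (ψ k)) = μ k • ψ k) {g : H}
    (hg : A g ∈ (Submodule.span ℝ (Set.range ψ)).topologicalClosure) (d : ℕ) :
    ‖A g‖ ^ 2 ≤ ∑ k ∈ Finset.range d, ⟪ψ k, A g⟫ ^ 2 + μ d * ‖g‖ ^ 2 := by
  set c : ℕ → ℝ := fun k => ⟪ψ k, A g⟫ with hc
  have hpiece : ∀ N, ∑ k ∈ Finset.Ico d N, c k ^ 2 ≤ μ d * ‖g‖ ^ 2 := fun N => by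
    set F := Finset.Ico d N
    set S := ∑ k ∈ F, c k ^ 2 with hS
    set w : E := ∑ k ∈ F, c k • ψ k with hw
    have h1 : ⟪g, A.adjoint w⟫ = S := by
      rw [ContinuousLinearMap.adjoint_inner_right, hw, inner_sum, hS]
      refine Finset.sum_congr rfl fun k _ => ?_
      rw [inner_smul_right, real_inner_comm, sq]
    have h2 : ‖A.adjoint w‖ ^ 2 ≤ μ d * S := by
      rw [← real_inner_self_eq_norm_sq, ContinuousLinearMap.adjoint_inner_left,
        real_inner_comm]
      have hAw : A (A.adjoint w) = ∑ k ∈ F, (c k * μ k) • ψ k := by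
        rw [hw, map_sum, map_sum]
        refine Finset.sum_congr rfl fun k _ => ?_
        rw [map_smul, map_smul, hA, smul_smul]
      rw [hAw, hw, hψ.inner_sum, hS, Finset.mul_sum]
      refine Finset.sum_le_sum fun k hk => ?_
      have := hμ (Finset.mem_Ico.1 hk).1
      simp only [conj_trivial]
      nlinarith [sq_nonneg (c k)]
    have h3 : S ^ 2 ≤ ‖g‖ ^ 2 * (μ d * S) := by
      rw [← h1]
      have := abs_real_inner_le_norm g (A.adjoint w)
      calc ⟪g, A.adjoint w⟫ ^ 2 = |⟪g, A.adjoint w⟫| ^ 2 := (sq_abs _).symm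
        _ ≤ (‖g‖ * ‖A.adjoint w‖) ^ 2 := by gcongr
        _ ≤ _ := by rw [mul_pow, h1]; gcongr
    have hS0 : 0 ≤ S := Finset.sum_nonneg fun k _ => sq_nonneg _
    rcases hS0.eq_or_lt with h0 | h0
    · rw [← h0]
      exact mul_nonneg (hμ0 d) (sq_nonneg _)
    · nlinarith
  have hsum := (hψ.hasSum_inner_sq_of_mem_closure hg).tendsto_sum_nat
  refine le_of_tendsto hsum (Filter.eventually_atTop.2 ⟨d, fun N hN => ?_⟩)
  rw [← Finset.sum_range_add_sum_Ico _ hN]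
  have := hpiece N
  linarith

namespace SparseAdditive

variable {H : Type*} [NormedAddCommGroup H] [InnerProductSpace ℝ H] [CompleteSpace H]
  [RKHS ℝ H unitInterval ℝ]

/-- The inclusion of a reproducing kernel Hilbert space of square integrable functions in
`L²([0,1])`. It is bounded by the closed graph theorem: convergence in `H` is pointwise, and
convergence in `L²` is almost everywhere along a subsequence. -/
noncomputable def inclusionL2
    (hm : ∀ g : H, MemLp (fun t => g t) 2 (volume : Measure unitInterval)) : H →L[ℝ] L2I :=
  ContinuousLinearMap.ofSeqClosedGraph
    (g := { toFun := fun g => (hm g).toLp _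
            map_add' := fun f g => by
              rw [← MemLp.toLp_add]
              exact MemLp.toLp_congr _ _ (by simp [Filter.EventuallyEq])
            map_smul' := fun c g => by
              rw [RingHom.id_apply, ← MemLp.toLp_const_smul]
              exact MemLp.toLp_congr _ _ (by simp [Filter.EventuallyEq]) })
    (fun u x y hux huy => by
      obtain ⟨φ, hφ, hlim⟩ := (tendstoInMeasure_of_tendsto_Lp huy).exists_seq_tendsto_ae
      apply Lp.ext
      have hall : ∀ᵐ t, ∀ n, (hm (u n)).toLp (fun t => u n t) t = u n t :=
        ae_all_iff.2 fun n => (hm (u n)).coeFn_toLp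
      filter_upwards [hlim, hall, (hm x).coeFn_toLp] with t h1 h2 h3
      refine tendsto_nhds_unique h1 ?_
      have h4 := ((RKHS.continuous_eval t).tendsto x).comp (hux.comp hφ.tendsto_atTop)
      refine (h4.congr fun n => (h2 (φ n)).symm).trans (le_of_eq ?_)
      exact congrArg nhds h3.symm)

lemma inclusionL2_apply (hm : ∀ g : H, MemLp (fun t => g t) 2 (volume : Measure unitInterval))
    (g : H) : inclusionL2 hm g = (hm g).toLp (fun t => g t) := rfl

/-- `ι ι†` is the integral operator of the kernel. -/
lemma inclusionL2_adjoint_apply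
    (hm : ∀ g : H, MemLp (fun t => g t) 2 (volume : Measure unitInterval)) (φ : L2I)
    (x : unitInterval) :
    ((inclusionL2 hm).adjoint φ : H) x = ∫ y, RKHS.kernel H x y 1 * φ y := by
  have h1 : ((inclusionL2 hm).adjoint φ : H) x =
      ⟪RKHS.kerFun H x (1 : ℝ), (inclusionL2 hm).adjoint φ⟫ := by
    rw [RKHS.kerFun_inner]; simp
  rw [h1, ContinuousLinearMap.adjoint_inner_right, L2.inner_def, inclusionL2_apply]
  refine integral_congr_ae ?_
  filter_upwards [(hm (RKHS.kerFun H x 1)).coeFn_toLp] with y hy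
  rw [hy, RKHS.kerFun_apply]
  have h2 : ∀ a b : unitInterval, RKHS.kernel H a b (1 : ℝ) =
      ⟪RKHS.kerFun H b (1 : ℝ), RKHS.kerFun H a (1 : ℝ)⟫ := fun a b => by
    rw [← RKHS.kernel_inner]; simp
  rw [h2, h2 x y, RCLike.inner_apply, conj_trivial, mul_comm, real_inner_comm]

/-- Functions in the unit ball of `H` have at most `μ d` of squared `L²` norm beyond the first `d`
eigenfunctions. -/
lemma IsCenteredEigensystem.norm_sq_le {μ : ℕ → ℝ} {ψ : ℕ → L2I}
    (h : IsCenteredEigensystem H μ ψ) (g : H) (hg : ‖g‖ ≤ 1) (d : ℕ) :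
    ‖(h.memLp g).toLp (fun t => g t)‖ ^ 2 ≤
      ∑ k ∈ Finset.range d, ⟪ψ k, (h.memLp g).toLp (fun t => g t)⟫ ^ 2 + μ d := by
  have hA : ∀ k, inclusionL2 h.memLp ((inclusionL2 h.memLp).adjoint (ψ k)) = μ k • ψ k := by
    intro k
    apply Lp.ext
    rw [inclusionL2_apply]
    filter_upwards [h.eigen k, (h.memLp ((inclusionL2 h.memLp).adjoint (ψ k))).coeFn_toLp,
      Lp.coeFn_smul (μ k) (ψ k)] with x h1 h2 h3
    rw [h2, h3, inclusionL2_adjoint_apply, h1]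
    rfl
  have := norm_sq_le_sum_inner_sq_add (inclusionL2 h.memLp) h.antitone
    h.nonneg h.orthonormal hA (h.span g) d
  refine this.trans ?_
  rw [inclusionL2_apply]
  have h0 := h.nonneg d
  have : ‖g‖ ^ 2 ≤ 1 := pow_le_one₀ (norm_nonneg _) hg
  nlinarith

end SparseAdditive

/-! ### Additive functions on the cube and their coefficients -/

namespace SparseAdditive

/-- The isometric embedding `φ ↦ (t ↦ φ (t j))` of `L²([0,1])` in `L²([0,1]^p)`. -/
noncomputable def coordEmbedding {p : ℕ} (j : Fin p) : L2I →ₗᵢ[ℝ] L2Cube p :=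
  Lp.compMeasurePreservingₗᵢ ℝ (fun t : Fin p → unitInterval => t j)
    (measurePreserving_eval (fun _ : Fin p => (volume : Measure unitInterval)) j)

lemma basisFun_eq_coordEmbedding {p : ℕ} (ψ : ℕ → L2I) (k : ℕ) (j : Fin p) :
    basisFun ψ k j = coordEmbedding j (ψ k) := rfl

lemma coeFn_coordEmbedding {p : ℕ} (j : Fin p) (φ : L2I) :
    coordEmbedding j φ =ᵐ[volume] fun t => φ (t j) :=
  Lp.coeFn_compMeasurePreserving φ
    (measurePreserving_eval (fun _ : Fin p => (volume : Measure unitInterval)) j)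

/-- Functions of different coordinates are orthogonal as soon as one of them is centred. -/
lemma inner_coordEmbedding_of_ne {p : ℕ} {i j : Fin p} (hij : i ≠ j) (φ χ : L2I)
    (hχ : ∫ t, χ t = 0) : ⟪coordEmbedding i φ, coordEmbedding j χ⟫ = 0 := by
  have hind : IndepFun (fun t : Fin p → unitInterval => φ (t i))
      (fun t : Fin p → unitInterval => χ (t j)) volume :=
    (iIndepFun_pi (μ := fun _ : Fin p => (volume : Measure unitInterval))
      (X := fun _ => id) (fun _ => aemeasurable_id)).indepFun hij |>.comp
      (Lp.stronglyMeasurable φ).measurable (Lp.stronglyMeasurable χ).measurable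
  have hm : ∀ (k : Fin p) (ξ : L2I), Measurable fun t : Fin p → unitInterval => ξ (t k) :=
    fun k ξ => (Lp.stronglyMeasurable ξ).measurable.comp (measurable_pi_apply k)
  rw [L2.inner_def]
  calc ∫ t, ⟪coordEmbedding i φ t, coordEmbedding j χ t⟫
      = ∫ t : Fin p → unitInterval, φ (t i) * χ (t j) := by
        refine integral_congr_ae ?_
        filter_upwards [coeFn_coordEmbedding i φ, coeFn_coordEmbedding j χ] with t h1 h2
        rw [h1, h2, RCLike.inner_apply, conj_trivial, mul_comm]
    _ = (∫ t : Fin p → unitInterval, φ (t i)) * ∫ t : Fin p → unitInterval, χ (t j) :=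
        hind.integral_fun_mul_eq_mul_integral (hm i φ).aestronglyMeasurable
          (hm j χ).aestronglyMeasurable
    _ = 0 := by
        rw [show ∫ t : Fin p → unitInterval, χ (t j) = ∫ t, χ t from
          integral_comp_eval (μ := fun _ : Fin p => (volume : Measure unitInterval))
            (Lp.stronglyMeasurable χ).aestronglyMeasurable, hχ, mul_zero]

variable {H : Type*} [NormedAddCommGroup H] [InnerProductSpace ℝ H] [CompleteSpace H]
  [RKHS ℝ H unitInterval ℝ] {μ : ℕ → ℝ} {ψ : ℕ → L2I} {p s : ℕ}

lemma IsCenteredEigensystem.inner_basisFun (h : IsCenteredEigensystem H μ ψ) (k l : ℕ)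
    (i j : Fin p) : ⟪basisFun ψ k i, basisFun ψ l j⟫ = if (i, k) = (j, l) then (1 : ℝ) else 0 := by
  rw [basisFun_eq_coordEmbedding, basisFun_eq_coordEmbedding]
  by_cases hij : i = j
  · subst hij
    rw [LinearIsometry.inner_map_map, orthonormal_iff_ite.1 h.orthonormal]
    simp
  · rw [inner_coordEmbedding_of_ne hij _ _ (h.integral_eigenfunction l)]
    simp [hij]

/-- A function of the parameter space has coefficients supported by at most `s` coordinates, and
each of these coordinates contributes at most `μ d` to the squared norm not captured by the first
`d` coefficients. -/
lemma IsCenteredEigensystem.exists_support (h : IsCenteredEigensystem H μ ψ) {f : L2Cube p}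
    (hf : f ∈ paramSpace H p s) :
    ∃ S : Finset (Fin p), S.card ≤ s ∧ (∀ j ∉ S, ∀ k, ⟪f, basisFun ψ k j⟫ = 0) ∧
      ∀ d, ‖f‖ ^ 2 ≤ ∑ j ∈ S, ∑ k ∈ Finset.range d, ⟪f, basisFun ψ k j⟫ ^ 2 + s * μ d := by
  obtain ⟨S, hS, g, hg, hfg⟩ := hf
  set u : Fin p → L2I := fun j => (h.memLp (g j)).toLp (fun t => g j t) with hu
  have hu0 : ∀ j, ∫ t, u j t = 0 := fun j => by
    rw [integral_congr_ae (h.memLp (g j)).coeFn_toLp, h.integral_eq_zero]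
  have hfu : f = ∑ j ∈ S, coordEmbedding j (u j) := by
    apply Lp.ext
    have h1 : ∀ᵐ t : Fin p → unitInterval, ∀ j, coordEmbedding j (u j) t = g j (t j) := by
      refine ae_all_iff.2 fun j => ?_
      have h2 := (measurePreserving_eval (fun _ : Fin p => (volume : Measure unitInterval))
        j).quasiMeasurePreserving.ae (h.memLp (g j)).coeFn_toLp
      filter_upwards [coeFn_coordEmbedding j (u j), h2] with t h3 h4
      rw [h3]
      exact h4
    filter_upwards [hfg, h1, Lp.coeFn_finsetSum S fun j => coordEmbedding j (u j)] with t h2 h3 h4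
    rw [h2, h4, Finset.sum_apply]
    exact Finset.sum_congr rfl fun j _ => (h3 j).symm
  have hin : ∀ j (χ : L2I), ∫ t, χ t = 0 →
      ⟪f, coordEmbedding j χ⟫ = if j ∈ S then ⟪u j, χ⟫ else 0 := fun j χ hχ => by
    rw [hfu, sum_inner]
    split_ifs with hj
    · rw [Finset.sum_eq_single_of_mem j hj fun i _ hij =>
        inner_coordEmbedding_of_ne hij _ _ hχ, LinearIsometry.inner_map_map]
    · exact Finset.sum_eq_zero fun i hi =>
        inner_coordEmbedding_of_ne (ne_of_mem_of_not_mem hi hj) _ _ hχ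
  have hnorm : ‖f‖ ^ 2 = ∑ j ∈ S, ‖u j‖ ^ 2 := by
    rw [← real_inner_self_eq_norm_sq]
    nth_rw 2 [hfu]
    rw [inner_sum]
    refine Finset.sum_congr rfl fun j hj => ?_
    rw [hin j _ (hu0 j), if_pos hj, real_inner_self_eq_norm_sq]
  refine ⟨S, hS, fun j hj k => ?_, fun d => ?_⟩
  · rw [basisFun_eq_coordEmbedding, hin j _ (h.integral_eigenfunction k), if_neg hj]
  · rw [hnorm]
    calc ∑ j ∈ S, ‖u j‖ ^ 2
        ≤ ∑ j ∈ S, (∑ k ∈ Finset.range d, ⟪f, basisFun ψ k j⟫ ^ 2 + μ d) := by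
          refine Finset.sum_le_sum fun j hj => ?_
          refine (h.norm_sq_le (g j) (hg j hj) d).trans (le_of_eq ?_)
          congr 1
          refine Finset.sum_congr rfl fun k _ => ?_
          rw [basisFun_eq_coordEmbedding, hin j _ (h.integral_eigenfunction k), if_pos hj,
            real_inner_comm]
      _ = ∑ j ∈ S, ∑ k ∈ Finset.range d, ⟪f, basisFun ψ k j⟫ ^ 2 + S.card * μ d := by
          rw [Finset.sum_add_distrib, Finset.sum_const, nsmul_eq_mul]
      _ ≤ _ := by
          have := h.nonneg d
          gcongr

lemma logTerm_pos (hs : 1 ≤ s) (hsp : (s : ℝ) < √p) : 1 / 2 ≤ logTerm p s := by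
  have hs' : (0 : ℝ) < s := by exact_mod_cast hs
  have h1 : (s : ℝ) ^ 2 < p := (Real.lt_sqrt hs'.le).1 hsp
  have h2 : 1 < (p : ℝ) / (s : ℝ) ^ 2 := (one_lt_div (by positivity)).2 h1
  refine le_trans ?_ (Real.log_le_log (by norm_num)
    (show (2 : ℝ) ≤ 1 + p / (s : ℝ) ^ 2 by linarith))
  linarith [Real.log_two_gt_d9]

lemma mul_exp_neg_logTerm_le (hs : 1 ≤ s) : p * Real.exp (-logTerm p s) ≤ (s : ℝ) ^ 2 := by
  have hs' : (0 : ℝ) < (s : ℝ) ^ 2 := by positivity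
  rw [logTerm, Real.exp_neg, Real.exp_log (by positivity), ← div_eq_mul_inv,
    div_le_iff₀ (by positivity)]
  field_simp
  linarith

lemma truncIndex_spec (hμ : ∀ k, μ k ≤ 1) {n : ℕ} (hn : 1 ≤ n) (hL : 0 < logTerm p s) :
    1 ≤ truncIndex μ p s n ∧
      μ (truncIndex μ p s n - 1) ≤ √(truncIndex μ p s n * logTerm p s) / n := by
  refine Nat.sInf_mem (s := {ν : ℕ | 1 ≤ ν ∧ μ (ν - 1) ≤ √(ν * logTerm p s) / n}) ?_
  obtain ⟨N, hN⟩ := exists_nat_ge ((n : ℝ) ^ 2 / logTerm p s)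
  rw [div_le_iff₀ hL] at hN
  refine ⟨N + 1, by simp, (hμ _).trans ?_⟩
  rw [one_le_div (by exact_mod_cast hn)]
  refine Real.le_sqrt_of_sq_le (hN.trans ?_)
  push_cast
  nlinarith

end SparseAdditive

/-! ### The thresholded chi-square variable -/

namespace SparseAdditive

/-- The contribution of a block of `d` scaled coefficients `v` to the thresholded statistic. -/
noncomputable def thresholdTerm (r : ℝ) (d : ℕ) (v : EuclideanSpace ℝ (Fin d)) : ℝ :=
  if d + r ^ 2 ≤ ‖v‖ ^ 2 then ‖v‖ ^ 2 - alpha r d else 0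

lemma measurable_thresholdTerm (r : ℝ) (d : ℕ) : Measurable (thresholdTerm r d) :=
  Measurable.ite (measurableSet_le measurable_const (by fun_prop)) (by fun_prop) measurable_const

lemma memLp_two_sq_norm_stdGaussian (d : ℕ) :
    MemLp (fun g : EuclideanSpace ℝ (Fin d) => ‖g‖ ^ 2) 2 (stdGaussian _) :=
  memLp_two_of_integrable_exp (by fun_prop) (fun _ => sq_nonneg _)
    (integrable_exp_sq_norm_div_four_stdGaussian d)

lemma stdGaussian_tail_pos {d : ℕ} (hd : 1 ≤ d) (r : ℝ) :
    0 < (stdGaussian (EuclideanSpace ℝ (Fin d))).real {g | d + r ^ 2 ≤ ‖g‖ ^ 2} :=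
  (Real.exp_pos _).trans_le (exp_le_stdGaussian_sq_norm_ge hd (by positivity))

lemma le_alpha {d : ℕ} (hd : 1 ≤ d) (r : ℝ) : d + r ^ 2 ≤ alpha r d :=
  le_truncatedMean (by fun_prop) ((memLp_two_sq_norm_stdGaussian d).integrable (by norm_num))
    (stdGaussian_tail_pos hd r)

lemma alpha_le {d : ℕ} (hd : 1 ≤ d) (r : ℝ) : alpha r d ≤ 8 * d + 4 * r ^ 2 + 12 := by
  have h := truncatedMean_le (t := d + r ^ 2) (b := d) (c := d + r ^ 2 + 2)
    ((memLp_two_sq_norm_stdGaussian d).integrable (by norm_num))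
    (integrable_exp_sq_norm_div_four_stdGaussian d)
    (integral_exp_sq_norm_div_four_stdGaussian_le d)
    (by rw [neg_add, ← sub_eq_add_neg]
        exact exp_le_stdGaussian_sq_norm_ge hd (by positivity))
  refine le_trans h (by linarith)

lemma thresholdTerm_eq_indicator (r : ℝ) (d : ℕ) : thresholdTerm r d =
    {v | d + r ^ 2 ≤ ‖v‖ ^ 2}.indicator fun v => ‖v‖ ^ 2 - alpha r d := by
  ext v
  simp [thresholdTerm, Set.indicator_apply]

lemma memLp_thresholdTerm (r : ℝ) (d : ℕ) : MemLp (thresholdTerm r d) 2 (stdGaussian _) := by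
  rw [thresholdTerm_eq_indicator]
  exact ((memLp_two_sq_norm_stdGaussian d).sub (memLp_const _)).indicator
    (measurableSet_le measurable_const (by fun_prop))

/-- The constant `alpha r d` centres the thresholded terms in the absence of signal. -/
lemma integral_thresholdTerm {d : ℕ} (hd : 1 ≤ d) (r : ℝ) :
    ∫ v, thresholdTerm r d v ∂(stdGaussian _) = 0 := by
  rw [thresholdTerm_eq_indicator,
    integral_indicator (measurableSet_le measurable_const (by fun_prop))]
  exact setIntegral_sub_truncatedMean
    ((memLp_two_sq_norm_stdGaussian d).integrable (by norm_num)) (stdGaussian_tail_pos hd r) rfl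

lemma integral_thresholdTerm_sq_le {d : ℕ} (hd : 1 ≤ d) (r : ℝ) :
    ∫ v, thresholdTerm r d v ^ 2 ∂(stdGaussian _) ≤ 32 * Real.exp (d - r ^ 2 / 4) := by
  have hsq : (fun v => thresholdTerm r d v ^ 2) =
      {v | d + r ^ 2 ≤ ‖v‖ ^ 2}.indicator fun v => (‖v‖ ^ 2 - alpha r d) ^ 2 := by
    ext v
    simp only [thresholdTerm, Set.indicator_apply, Set.mem_ofPred_eq]
    split_ifs <;> simp
  rw [hsq, integral_indicator (measurableSet_le measurable_const (by fun_prop))]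
  refine (setIntegral_sub_truncatedMean_sq_le (by fun_prop) (memLp_two_sq_norm_stdGaussian d)
    (integrable_exp_sq_norm_div_four_stdGaussian d) (stdGaussian_tail_pos hd r) rfl).trans ?_
  calc 32 * Real.exp (-(d + r ^ 2) / 4) *
        ∫ g, Real.exp (‖g‖ ^ 2 / 4) ∂(stdGaussian (EuclideanSpace ℝ (Fin d)))
      ≤ 32 * Real.exp (-(d + r ^ 2) / 4) * Real.exp d := by
        gcongr
        exact integral_exp_sq_norm_div_four_stdGaussian_le d
    _ = 32 * Real.exp (-(d + r ^ 2) / 4 + d) := by rw [mul_assoc, ← Real.exp_add]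
    _ ≤ _ := by
        gcongr
        have : (0 : ℝ) ≤ d := by positivity
        linarith

end SparseAdditive

/-! ### The statistic in the white noise model -/

namespace SparseAdditive

section Model

variable {H : Type*} [NormedAddCommGroup H] [InnerProductSpace ℝ H] [CompleteSpace H]
  [RKHS ℝ H unitInterval ℝ] {μ : ℕ → ℝ} {ψ : ℕ → L2I} {p n : ℕ}
  {Ω : Type*} [MeasurableSpace Ω] {f : L2Cube p} {Y : L2Cube p → Ω → ℝ} {P : Measure Ω}

/-- The coefficient data scaled to unit variance, `√n X_{k,j}`. -/
noncomputable def scaledCoeff (ψ : ℕ → L2I) (Y : L2Cube p → Ω → ℝ) (n : ℕ) (q : Fin p × ℕ)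
    (ω : Ω) : ℝ :=
  √n * coeffData ψ Y q.2 q.1 ω

/-- The first `d` scaled coefficients of the `j`-th coordinate. -/
noncomputable def scaledBlock (ψ : ℕ → L2I) (Y : L2Cube p → Ω → ℝ) (n d : ℕ) (j : Fin p) (ω : Ω) :
    EuclideanSpace ℝ (Fin d) :=
  WithLp.toLp 2 fun k : Fin d => scaledCoeff ψ Y n (j, k) ω

omit [MeasurableSpace Ω] in
lemma sq_norm_scaledBlock (d : ℕ) (j : Fin p) (ω : Ω) :
    ‖scaledBlock ψ Y n d j ω‖ ^ 2 = ∑ k ∈ Finset.range d, scaledCoeff ψ Y n (j, k) ω ^ 2 := by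
  rw [EuclideanSpace.real_norm_sq_eq, Finset.sum_range]
  rfl

omit [MeasurableSpace Ω] in
lemma energy_eq_sq_norm (d : ℕ) (j : Fin p) (ω : Ω) :
    energy ψ Y n d j ω = ‖scaledBlock ψ Y n d j ω‖ ^ 2 := by
  rw [sq_norm_scaledBlock, energy, Finset.mul_sum]
  refine Finset.sum_congr rfl fun k _ => ?_
  rw [scaledCoeff, mul_pow, Real.sq_sqrt (Nat.cast_nonneg n)]

omit [MeasurableSpace Ω] in
lemma thresholdStat_eq_sum (r : ℝ) (d : ℕ) (ω : Ω) :
    thresholdStat ψ Y n r d ω = ∑ j, thresholdTerm r d (scaledBlock ψ Y n d j ω) := by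
  simp only [thresholdStat, thresholdTerm, energy_eq_sq_norm]

lemma IsWhiteNoiseModel.isGaussianProcess_scaledCoeff (hY : IsWhiteNoiseModel n f Y P) :
    IsGaussianProcess (scaledCoeff ψ Y n) P :=
  (hY.gaussian.comp_right fun q : Fin p × ℕ => basisFun ψ q.2 q.1).smul fun _ => √n

lemma IsWhiteNoiseModel.integral_scaledCoeff (hY : IsWhiteNoiseModel n f Y P) (q : Fin p × ℕ) :
    ∫ ω, scaledCoeff ψ Y n q ω ∂P = √n * ⟪f, basisFun ψ q.2 q.1⟫ := by
  simp only [scaledCoeff, coeffData]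
  rw [integral_const_mul, hY.mean]

lemma IsWhiteNoiseModel.cov_scaledCoeff (hY : IsWhiteNoiseModel n f Y P)
    (h : IsCenteredEigensystem H μ ψ) (hn : 1 ≤ n) (q q' : Fin p × ℕ) :
    cov[scaledCoeff ψ Y n q, scaledCoeff ψ Y n q'; P] = if q = q' then 1 else 0 := by
  have hn' : (0 : ℝ) < n := by exact_mod_cast hn
  have h1 : cov[scaledCoeff ψ Y n q, scaledCoeff ψ Y n q'; P] =
      √n * (√n * cov[Y (basisFun ψ q.2 q.1), Y (basisFun ψ q'.2 q'.1); P]) := by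
    rw [← covariance_const_mul_right, ← covariance_const_mul_left]
    rfl
  rw [h1, hY.cov, h.inner_basisFun, ← mul_assoc, Real.mul_self_sqrt hn'.le]
  split_ifs <;> field_simp

lemma IsWhiteNoiseModel.variance_scaledCoeff (hY : IsWhiteNoiseModel n f Y P)
    (h : IsCenteredEigensystem H μ ψ) (hn : 1 ≤ n) (q : Fin p × ℕ) :
    Var[scaledCoeff ψ Y n q; P] = 1 := by
  rw [← covariance_self (hY.isGaussianProcess_scaledCoeff.aemeasurable q),
    hY.cov_scaledCoeff h hn, if_pos rfl]

lemma IsWhiteNoiseModel.aemeasurable_scaledBlock (hY : IsWhiteNoiseModel n f Y P) (d : ℕ)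
    (j : Fin p) : AEMeasurable (scaledBlock ψ Y n d j) P :=
  (by fun_prop : Measurable
      (WithLp.toLp 2 : (Fin d → ℝ) → EuclideanSpace ℝ (Fin d))).comp_aemeasurable
    (aemeasurable_pi_lambda _ fun _ => hY.isGaussianProcess_scaledCoeff.aemeasurable _)

lemma IsWhiteNoiseModel.iIndepFun_scaledBlock (hY : IsWhiteNoiseModel n f Y P)
    (h : IsCenteredEigensystem H μ ψ) (hn : 1 ≤ n) (d : ℕ) :
    iIndepFun (scaledBlock ψ Y n d) P := by
  have hG := hY.isGaussianProcess_scaledCoeff (ψ := ψ)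
  have h1 : iIndepFun (fun (j : Fin p) ω (k : Fin d) => scaledCoeff ψ Y n (j, k) ω) P :=
    (hG.comp_right fun q : (_ : Fin p) × Fin d => (q.1, (q.2 : ℕ))).iIndepFun_of_covariance_eq_zero
      (X := fun j (k : Fin d) => scaledCoeff ψ Y n (j, k)) (fun j k => hG.aemeasurable _)
      fun i j hij k l => by
        rw [hY.cov_scaledCoeff h hn, if_neg (by simp [hij])]
  exact h1.comp (fun _ => WithLp.toLp 2) fun _ => by fun_prop

/-- A block of coefficients without signal is standard Gaussian. -/
lemma IsWhiteNoiseModel.map_scaledBlock (hY : IsWhiteNoiseModel n f Y P)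
    (h : IsCenteredEigensystem H μ ψ) (hn : 1 ≤ n) (d : ℕ) {j : Fin p}
    (hj : ∀ k, ⟪f, basisFun ψ k j⟫ = 0) :
    P.map (scaledBlock ψ Y n d j) = stdGaussian (EuclideanSpace ℝ (Fin d)) := by
  have hG := hY.isGaussianProcess_scaledCoeff (ψ := ψ)
  have := hG.isProbabilityMeasure
  have hlaw : ∀ k : Fin d, P.map (scaledCoeff ψ Y n (j, k)) = gaussianReal 0 1 := fun k => by
    rw [(hG.hasGaussianLaw_eval _).map_eq_gaussianReal, hY.integral_scaledCoeff,
      hY.variance_scaledCoeff h hn, hj]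
    simp
  have hind : iIndepFun (fun (k : Fin d) ω => scaledCoeff ψ Y n (j, k) ω) P := by
    have h1 := (hG.comp_right fun q : (_ : Fin d) × Unit =>
      (j, (q.1 : ℕ))).iIndepFun_of_covariance_eq_zero
      (X := fun (k : Fin d) (_ : Unit) => scaledCoeff ψ Y n (j, k)) (fun _ _ => hG.aemeasurable _)
      fun k l hkl _ _ => by
        rw [hY.cov_scaledCoeff h hn, if_neg (by simpa [Fin.ext_iff] using hkl)]
    exact h1.comp (fun _ v => v ()) fun _ => by fun_prop
  have hmap := (iIndepFun_iff_map_fun_eq_pi_map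
    fun k : Fin d => hG.aemeasurable (j, (k : ℕ))).1 hind
  simp only [hlaw] at hmap
  rw [← map_pi_eq_stdGaussian, ← hmap, AEMeasurable.map_map_of_aemeasurable (by fun_prop)
    (aemeasurable_pi_lambda _ fun _ => hG.aemeasurable _)]
  rfl

/-- Chebyshev's inequality for the contribution to the statistic of coordinates without signal. -/
lemma IsWhiteNoiseModel.measure_abs_noise_ge_le (hY : IsWhiteNoiseModel n f Y P)
    (h : IsCenteredEigensystem H μ ψ) (hn : 1 ≤ n) {d : ℕ} (hd : 1 ≤ d) (r : ℝ)
    (S : Finset (Fin p)) (hS : ∀ j ∈ S, ∀ k, ⟪f, basisFun ψ k j⟫ = 0) {c : ℝ} (hc : 0 < c) :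
    P {ω | c ≤ |∑ j ∈ S, thresholdTerm r d (scaledBlock ψ Y n d j ω)|} ≤
      ENNReal.ofReal (p * (32 * Real.exp (d - r ^ 2 / 4)) / c ^ 2) := by
  have := hY.gaussian.isProbabilityMeasure
  set Z : Fin p → Ω → ℝ := fun j ω => thresholdTerm r d (scaledBlock ψ Y n d j ω) with hZ
  have hmeas := measurable_thresholdTerm r d
  have hVm := fun j => hY.aemeasurable_scaledBlock (ψ := ψ) d j
  have hZm : ∀ j, AEMeasurable (Z j) P := fun j => hmeas.comp_aemeasurable (hVm j)
  have hZL : ∀ j ∈ S, MemLp (Z j) 2 P := fun j hj => by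
    have h1 := memLp_thresholdTerm r d
    rw [← hY.map_scaledBlock h hn d (hS j hj)] at h1
    exact (memLp_map_measure_iff hmeas.aestronglyMeasurable (hVm j)).1 h1
  have hZ0 : ∀ j ∈ S, ∫ ω, Z j ω ∂P = 0 := fun j hj => by
    rw [← integral_thresholdTerm hd r, ← hY.map_scaledBlock h hn d (hS j hj),
      integral_map (hVm j) hmeas.aestronglyMeasurable]
  have hZ2 : ∀ j ∈ S, Var[Z j; P] ≤ 32 * Real.exp (d - r ^ 2 / 4) := fun j hj => by
    rw [variance_of_integral_eq_zero (hZm j) (hZ0 j hj)]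
    refine le_trans (le_of_eq ?_) (integral_thresholdTerm_sq_le hd r)
    rw [← hY.map_scaledBlock h hn d (hS j hj),
      integral_map (hVm j) (hmeas.pow_const 2).aestronglyMeasurable]
  have hmean : ∫ ω, (∑ j ∈ S, Z j) ω ∂P = 0 := by
    simp only [Finset.sum_apply]
    rw [integral_finsetSum _ fun j hj => (hZL j hj).integrable (by norm_num)]
    exact Finset.sum_eq_zero hZ0
  have hvar : Var[∑ j ∈ S, Z j; P] ≤ p * (32 * Real.exp (d - r ^ 2 / 4)) := by
    have hind := (hY.iIndepFun_scaledBlock h hn d).comp (fun _ => thresholdTerm r d) fun _ => hmeas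
    rw [IndepFun.variance_sum hZL fun i _ j _ hij => hind.indepFun hij]
    refine (Finset.sum_le_card_nsmul S _ _ hZ2).trans ?_
    rw [nsmul_eq_mul]
    gcongr
    simpa using Finset.card_le_univ S
  have hcheb := meas_ge_le_variance_div_sq (memLp_finsetSum' S hZL) hc
  rw [hmean] at hcheb
  simp only [sub_zero, Finset.sum_apply] at hcheb
  refine hcheb.trans (ENNReal.ofReal_le_ofReal ?_)
  gcongr

/-- The energy of the blocks in `S` exceeds half of the energy `lam` of the signal, with high
probability. As `∑ x² ≥ 2 ∑ m x - ∑ m²`, where `m` is the mean of the scaled data `x`, this is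
Chebyshev's inequality for the linear statistic `∑ m x`, whose mean and variance are `lam`. -/
lemma IsWhiteNoiseModel.measure_energy_le_le (hY : IsWhiteNoiseModel n f Y P)
    (h : IsCenteredEigensystem H μ ψ) (hn : 1 ≤ n) (d : ℕ) (S : Finset (Fin p)) {lam : ℝ}
    (hlam : lam = n * ∑ j ∈ S, ∑ k ∈ Finset.range d, ⟪f, basisFun ψ k j⟫ ^ 2) (hpos : 0 < lam) :
    P {ω | ∑ j ∈ S, ‖scaledBlock ψ Y n d j ω‖ ^ 2 ≤ lam / 2} ≤ ENNReal.ofReal (16 / lam) := by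
  have hG := hY.isGaussianProcess_scaledCoeff (ψ := ψ)
  have := hG.isProbabilityMeasure
  set F : Finset (Fin p × ℕ) := S ×ˢ Finset.range d with hF
  set m : Fin p × ℕ → ℝ := fun q => √n * ⟪f, basisFun ψ q.2 q.1⟫ with hm
  have hm2 : ∑ q ∈ F, m q ^ 2 = lam := by
    rw [hlam, hF, Finset.sum_product, Finset.mul_sum]
    refine Finset.sum_congr rfl fun j _ => ?_
    rw [Finset.mul_sum]
    refine Finset.sum_congr rfl fun k _ => ?_
    rw [hm]
    simp only
    rw [mul_pow, Real.sq_sqrt (Nat.cast_nonneg n)]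
  set W : Fin p × ℕ → Ω → ℝ := fun q ω => m q * scaledCoeff ψ Y n q ω with hW
  have hWL : ∀ q ∈ F, MemLp (W q) 2 P := fun q _ =>
    (hG.hasGaussianLaw_eval q).memLp_two.const_mul (m q)
  have hmean : ∫ ω, (∑ q ∈ F, W q) ω ∂P = lam := by
    simp only [Finset.sum_apply]
    rw [integral_finsetSum _ fun q hq => (hWL q hq).integrable (by norm_num), ← hm2]
    refine Finset.sum_congr rfl fun q _ => ?_
    rw [hW]
    simp only
    rw [integral_const_mul, hY.integral_scaledCoeff, sq]
  have hvar : Var[∑ q ∈ F, W q; P] = lam := by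
    rw [IndepFun.variance_sum hWL, ← hm2]
    · refine Finset.sum_congr rfl fun q _ => ?_
      rw [hW]
      simp only
      rw [variance_const_mul, hY.variance_scaledCoeff h hn, mul_one]
    · intro q _ q' _ hqq
      have hind : IndepFun (scaledCoeff ψ Y n q) (scaledCoeff ψ Y n q') P :=
        hG.hasGaussianLaw_prodMk.indepFun_of_covariance_eq_zero
          (by rw [hY.cov_scaledCoeff h hn, if_neg hqq])
      exact hind.comp (measurable_const_mul (m q)) (measurable_const_mul (m q'))
  have hcheb := meas_ge_le_variance_div_sq (memLp_finsetSum' F hWL)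
    (show 0 < lam / 4 by positivity)
  rw [hmean, hvar, show lam / (lam / 4) ^ 2 = 16 / lam by field_simp; norm_num] at hcheb
  refine (measure_mono fun ω hω => ?_).trans hcheb
  simp only [Set.mem_ofPred_eq, Finset.sum_apply] at hω ⊢
  have hE : 2 * ∑ q ∈ F, W q ω - lam ≤ ∑ j ∈ S, ‖scaledBlock ψ Y n d j ω‖ ^ 2 := by
    simp only [sq_norm_scaledBlock]
    rw [← Finset.sum_product S (Finset.range d) fun q => scaledCoeff ψ Y n q ω ^ 2, ← hm2,
      Finset.mul_sum, ← Finset.sum_sub_distrib]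
    refine Finset.sum_le_sum fun q _ => ?_
    nlinarith [sq_nonneg (scaledCoeff ψ Y n q ω - m q)]
  rw [le_abs]
  right
  linarith

end Model

end SparseAdditive

/-! ### The two errors of the test -/

namespace SparseAdditive

lemma nat_mul_tau_sq {p s n : ℕ} (hn : 1 ≤ n) (hL : 0 ≤ logTerm p s) :
    n * tau p s n ^ 2 = s * logTerm p s := by
  have hn' : (0 : ℝ) < n := by exact_mod_cast hn
  rw [tau, Real.sq_sqrt (by positivity)]
  field_simp

section Risk

variable {H : Type*} [NormedAddCommGroup H] [InnerProductSpace ℝ H] [CompleteSpace H]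
  [RKHS ℝ H unitInterval ℝ] {μ : ℕ → ℝ} {ψ : ℕ → L2I} {p s n d : ℕ} {K₃ C r : ℝ}
  {Ω : Type*} [MeasurableSpace Ω] {f : L2Cube p} {Y : L2Cube p → Ω → ℝ} {P : Measure Ω}

/-- The eigenvalue bound that makes the truncation bias negligible. -/
lemma IsCenteredEigensystem.eigenvalue_le (h : IsCenteredEigensystem H μ ψ) (hn : 1 ≤ n)
    (hL : 0 < logTerm p s) (hK₃ : 0 < K₃) (hd : truncIndex μ p s n ≤ d)
    (hdL : K₃ ^ 2 * d ≤ logTerm p s) : n * μ d ≤ logTerm p s / K₃ := by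
  have hn' : (0 : ℝ) < n := by exact_mod_cast hn
  obtain ⟨-, h2⟩ := truncIndex_spec (fun k => h.first ▸ h.antitone (Nat.zero_le k)) hn hL
  have h3 : μ d ≤ μ (truncIndex μ p s n - 1) := h.antitone (by omega)
  have h4 : √(truncIndex μ p s n * logTerm p s) ≤ logTerm p s / K₃ := by
    refine Real.sqrt_le_iff.2 ⟨by positivity, ?_⟩
    have h5 : (truncIndex μ p s n : ℝ) ≤ d := by exact_mod_cast hd
    rw [div_pow, le_div_iff₀ (by positivity)]
    calc truncIndex μ p s n * logTerm p s * K₃ ^ 2 ≤ d * logTerm p s * K₃ ^ 2 := by gcongr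
      _ = K₃ ^ 2 * d * logTerm p s := by ring
      _ ≤ logTerm p s * logTerm p s := by gcongr
      _ = _ := by ring
  rw [mul_comm, ← le_div_iff₀ hn']
  exact h3.trans (h2.trans (by gcongr))

/-- In the regime of the threshold `r`, the contribution of the coordinates without signal is of
order `s`, hence small compared with `s log(1 + p / s²)`. -/
lemma IsWhiteNoiseModel.measure_abs_noise_ge_le_div (hY : IsWhiteNoiseModel n f Y P)
    (h : IsCenteredEigensystem H μ ψ) (hn : 1 ≤ n) (hd : 1 ≤ d) (hs : 1 ≤ s)
    (hL : 1 / 2 ≤ logTerm p s) (hr : d + logTerm p s ≤ r ^ 2 / 4) (hC : 1 ≤ C)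
    (S : Finset (Fin p)) (hS : ∀ j ∈ S, ∀ k, ⟪f, basisFun ψ k j⟫ = 0) :
    P {ω | C * (s * logTerm p s) ≤ |∑ j ∈ S, thresholdTerm r d (scaledBlock ψ Y n d j ω)|} ≤
      ENNReal.ofReal (128 / C) := by
  have hs' : (1 : ℝ) ≤ s := by exact_mod_cast hs
  refine (hY.measure_abs_noise_ge_le h hn hd r S hS (by positivity)).trans
    (ENNReal.ofReal_le_ofReal ?_)
  have h1 : p * Real.exp (d - r ^ 2 / 4) ≤ (s : ℝ) ^ 2 := by
    refine le_trans ?_ (mul_exp_neg_logTerm_le (p := p) hs)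
    gcongr
    linarith
  have h2 : (s : ℝ) ^ 2 * C ≤ 4 * (C * (s * logTerm p s)) ^ 2 := by
    calc (s : ℝ) ^ 2 * C ≤ (s : ℝ) ^ 2 * C ^ 2 := by gcongr; nlinarith
      _ = 4 * (C * (s * (1 / 2))) ^ 2 := by ring
      _ ≤ _ := by gcongr
  rw [div_le_div_iff₀ (by positivity) (by positivity)]
  nlinarith

/-- Type I error: without signal the whole statistic is noise. -/
lemma IsWhiteNoiseModel.measure_thresholdStat_gt_le (hY : IsWhiteNoiseModel n 0 Y P)
    (h : IsCenteredEigensystem H μ ψ) (hn : 1 ≤ n) (hd : 1 ≤ d) (hs : 1 ≤ s)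
    (hL : 1 / 2 ≤ logTerm p s) (hr : d + logTerm p s ≤ r ^ 2 / 4) (hC : 1 ≤ C) :
    P {ω | C * (s * logTerm p s) < thresholdStat ψ Y n r d ω} ≤ ENNReal.ofReal (128 / C) := by
  refine (measure_mono fun ω hω => ?_).trans (hY.measure_abs_noise_ge_le_div h hn hd hs hL hr hC
    Finset.univ fun j _ k => inner_zero_left _)
  simp only [Set.mem_ofPred_eq, thresholdStat_eq_sum] at hω ⊢
  exact hω.le.trans (le_abs_self _)

/-- Type II error. On the support `S` of the signal every term of the statistic is at least
`E_j - α`, because `α` exceeds the threshold. -/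
lemma IsWhiteNoiseModel.measure_thresholdStat_le_le (hY : IsWhiteNoiseModel n f Y P)
    (h : IsCenteredEigensystem H μ ψ) (hn : 1 ≤ n) (hd : 1 ≤ d) (hs : 1 ≤ s)
    (hL : 1 / 2 ≤ logTerm p s) (hr : d + logTerm p s ≤ r ^ 2 / 4) (hK₃ : 0 < K₃)
    (hν : truncIndex μ p s n ≤ d) (hdL : K₃ ^ 2 * d ≤ logTerm p s) {A : ℝ}
    (hα : alpha r d ≤ A * logTerm p s) (hC : 16 ≤ C) (hCA : 8 * A ≤ C) (hCK : 2 / K₃ ≤ C)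
    (hf : f ∈ paramSpace H p s) (hfn : C * tau p s n ≤ ‖f‖) :
    P {ω | thresholdStat ψ Y n r d ω ≤ C * (s * logTerm p s)} ≤ ENNReal.ofReal (192 / C) := by
  have hn' : (0 : ℝ) < n := by exact_mod_cast hn
  have hs' : (1 : ℝ) ≤ s := by exact_mod_cast hs
  have hM : 1 / 2 ≤ s * logTerm p s := by nlinarith
  obtain ⟨S, hScard, hS0, hSd⟩ := h.exists_support hf
  set lam : ℝ := n * ∑ j ∈ S, ∑ k ∈ Finset.range d, ⟪f, basisFun ψ k j⟫ ^ 2 with hlam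
  -- the signal left after truncation
  have hlam_ge : C ^ 2 / 2 * (s * logTerm p s) ≤ lam := by
    have h1 : n * ‖f‖ ^ 2 ≤ lam + s * (n * μ d) := by
      rw [hlam]
      nlinarith [hSd d]
    have h2 : C ^ 2 * (s * logTerm p s) ≤ n * ‖f‖ ^ 2 := by
      rw [← nat_mul_tau_sq hn (by linarith)]
      calc C ^ 2 * (n * tau p s n ^ 2) = n * (C * tau p s n) ^ 2 := by ring
        _ ≤ _ := by
          have : 0 ≤ C * tau p s n := mul_nonneg (by linarith) (Real.sqrt_nonneg _)
          gcongr
    have h3 : s * (n * μ d) ≤ 1 / K₃ * (s * logTerm p s) := by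
      calc s * (n * μ d) ≤ s * (logTerm p s / K₃) := by
            gcongr
            exact h.eigenvalue_le hn (by linarith) hK₃ hν hdL
        _ = _ := by ring
    have h4 : 1 / K₃ ≤ C ^ 2 / 2 := by
      have : 2 / K₃ = 2 * (1 / K₃) := by ring
      nlinarith
    nlinarith
  have hlam_pos : 0 < lam := lt_of_lt_of_le (by positivity) hlam_ge
  set N : Ω → ℝ := fun ω => ∑ j ∈ Sᶜ, thresholdTerm r d (scaledBlock ψ Y n d j ω) with hN
  have hsub : {ω | thresholdStat ψ Y n r d ω ≤ C * (s * logTerm p s)} ⊆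
      {ω | ∑ j ∈ S, ‖scaledBlock ψ Y n d j ω‖ ^ 2 ≤ lam / 2} ∪
        {ω | C * (s * logTerm p s) ≤ |N ω|} := by
    intro ω hω
    by_contra hcon
    simp only [Set.mem_union, Set.mem_ofPred_eq, not_or, not_le] at hcon hω
    obtain ⟨hE, hNω⟩ := hcon
    have h1 : ∑ j ∈ S, (‖scaledBlock ψ Y n d j ω‖ ^ 2 - alpha r d) ≤
        ∑ j ∈ S, thresholdTerm r d (scaledBlock ψ Y n d j ω) := by
      refine Finset.sum_le_sum fun j _ => ?_
      rw [thresholdTerm]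
      split_ifs with hj
      · exact le_rfl
      · linarith [le_alpha hd r]
    have h2 : S.card * alpha r d ≤ s * (A * logTerm p s) := by
      have h3 : 0 ≤ alpha r d := le_trans (by positivity) (le_alpha hd r)
      have h4 : (S.card : ℝ) ≤ s := by exact_mod_cast hScard
      gcongr
    rw [Finset.sum_sub_distrib, Finset.sum_const, nsmul_eq_mul] at h1
    rw [thresholdStat_eq_sum, ← Finset.sum_add_sum_compl S] at hω
    have h5 := neg_lt_of_abs_lt hNω
    have h6 : (2 * C + A) * (s * logTerm p s) ≤ C ^ 2 / 4 * (s * logTerm p s) := by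
      gcongr
      nlinarith
    simp only [hN] at h5
    linarith
  calc P {ω | thresholdStat ψ Y n r d ω ≤ C * (s * logTerm p s)}
      ≤ P {ω | ∑ j ∈ S, ‖scaledBlock ψ Y n d j ω‖ ^ 2 ≤ lam / 2} +
        P {ω | C * (s * logTerm p s) ≤ |N ω|} :=
        (measure_mono hsub).trans (measure_union_le _ _)
    _ ≤ ENNReal.ofReal (16 / lam) + ENNReal.ofReal (128 / C) := by
        gcongr
        · exact hY.measure_energy_le_le h hn d S hlam hlam_pos
        · exact hY.measure_abs_noise_ge_le_div h hn hd hs hL hr (by linarith) _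
            fun j hj => hS0 j (Finset.mem_compl.1 hj)
    _ ≤ ENNReal.ofReal (64 / C) + ENNReal.ofReal (128 / C) := by
        gcongr ENNReal.ofReal ?_ + _
        rw [div_le_div_iff₀ hlam_pos (by positivity)]
        nlinarith
    _ = ENNReal.ofReal (192 / C) := by
        rw [← ENNReal.ofReal_add (by positivity) (by positivity)]
        congr 1
        ring

end Risk

end SparseAdditive

theorem mainTheorem3 (K₃ : ℝ) (hK₃ : 0 < K₃) :
    ∃ K₁ > (0 : ℝ), ∃ K₂ > (0 : ℝ), ∀ η ∈ Set.Ioo (0 : ℝ) 1, ∃ Cη > (0 : ℝ),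
      ∀ (D : ℝ) (_ : 0 < D)
        (H : Type*) [NormedAddCommGroup H] [InnerProductSpace ℝ H] [CompleteSpace H]
        [RKHS ℝ H unitInterval ℝ] (μ : ℕ → ℝ) (ψ : ℕ → L2I) (_ : IsCenteredEigensystem H μ ψ)
        (p s n : ℕ) (_ : 1 ≤ s) (_ : (s : ℝ) < √p) (_ : 1 ≤ n)
        (Ω : Type*) [MeasurableSpace Ω] (Y : L2Cube p → Ω → ℝ) (P : L2Cube p → Measure Ω)
        (_ : ∀ f, IsWhiteNoiseModel n f Y (P f))
        (d : ℕ) (_ : d = max (truncIndex μ p s n) ⌈D⌉₊) (_ : K₃ ^ 2 * d ≤ logTerm p s)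
        (C : ℝ) (_ : Cη < C),
        totalRisk P (thresholdStat ψ Y n (K₂ * √(logTerm p s)) d)
            (C * K₁ * n * tau p s n ^ 2)
            {f | f ∈ paramSpace H p s ∧ C * tau p s n ≤ ‖f‖}
          ≤ ENNReal.ofReal η := by
  -- `K₂` is large enough for `K₂² / 4 ≥ 1 + 1 / K₃²`
  set K₂ : ℝ := 4 + 2 / K₃ with hK₂
  -- a constant with `alpha r d ≤ A * log(1 + p / s²)`
  set A : ℝ := 8 / K₃ ^ 2 + 4 * K₂ ^ 2 + 24 with hA
  refine ⟨1, one_pos, K₂, by positivity, fun η hη => ?_⟩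
  have hη0 : 0 < η := hη.1
  -- the summands absorb the noise, the bias and the centring by `alpha`, and give `192 / C ≤ η / 2`
  refine ⟨16 + 2 / K₃ + 8 * A + 384 / η, by positivity, ?_⟩
  intro D hD H _ _ _ _ μ ψ h p s n hs hsp hn Ω _ Y P hY d hd hdL C hC
  have hL := logTerm_pos hs hsp
  have hL0 : 0 < logTerm p s := by linarith
  have hν : truncIndex μ p s n ≤ d := hd ▸ le_max_left _ _
  have hd1 : 1 ≤ d :=
    (truncIndex_spec (fun k => h.first ▸ h.antitone (Nat.zero_le k)) hn hL0).1.trans hν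
  have hdL' : (d : ℝ) ≤ 1 / K₃ ^ 2 * logTerm p s := by
    rw [one_div, inv_mul_eq_div, le_div_iff₀ (by positivity)]
    linarith
  have hr2 : (K₂ * √(logTerm p s)) ^ 2 = K₂ ^ 2 * logTerm p s := by
    rw [mul_pow, Real.sq_sqrt hL0.le]
  have hr : d + logTerm p s ≤ (K₂ * √(logTerm p s)) ^ 2 / 4 := by
    have h1 : 1 / K₃ ^ 2 + 1 ≤ K₂ ^ 2 / 4 := by
      rw [show K₂ ^ 2 / 4 = 1 / K₃ ^ 2 + 4 + 4 / K₃ by rw [hK₂]; field_simp; ring]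
      have : 0 < 4 / K₃ := by positivity
      linarith
    rw [hr2]
    nlinarith
  have hα : alpha (K₂ * √(logTerm p s)) d ≤ A * logTerm p s := by
    have h1 := alpha_le hd1 (K₂ * √(logTerm p s))
    rw [hr2] at h1
    rw [hA, show (8 / K₃ ^ 2 + 4 * K₂ ^ 2 + 24) * logTerm p s = 8 * (1 / K₃ ^ 2 * logTerm p s) +
      4 * (K₂ ^ 2 * logTerm p s) + 24 * logTerm p s by ring]
    linarith
  have e1 : 0 < 2 / K₃ := by positivity
  have e2 : 0 < A := by positivity
  have e3 : 0 < 384 / η := by positivity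
  have hu : C * 1 * n * tau p s n ^ 2 = C * (s * logTerm p s) := by
    rw [← nat_mul_tau_sq hn hL0.le]; ring
  have hCη : 192 / C ≤ η / 2 := by
    have h1 : 384 / η < C := by linarith
    rw [div_lt_iff₀ hη0] at h1
    rw [div_le_iff₀ (by linarith)]
    linarith
  have hCη' : 128 / C ≤ η / 2 := by
    have hC0 : 0 < C := by linarith
    exact le_trans (by gcongr; norm_num) hCη
  rw [totalRisk, hu, ← add_halves η, ENNReal.ofReal_add (by positivity) (by positivity)]
  refine add_le_add ?_ (iSup₂_le fun f hf => ?_)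
  · exact ((hY 0).measure_thresholdStat_gt_le h hn hd1 hs hL hr (by linarith)).trans
      (ENNReal.ofReal_le_ofReal hCη')
  · exact ((hY f).measure_thresholdStat_le_le h hn hd1 hs hL hr hK₃ hν hdL hα (by linarith)
      (by linarith) (by linarith) hf.1 hf.2).trans (ENNReal.ofReal_le_ofReal hCη)
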